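/- For a real sequence $a=(a_k)_{k\ge1}$ tending to $0$, let $a^*=(a^*_n)_{n\ge1}$ be the decreasing rearrangement of $(|a_k|)$. A \emph{Marcinkiewicz sequence space} is a real Banach space $E$ with a Schauder basis $(e_k)$ for which there is a sequence $(t_n)$ of strictly positive reals decreasing to $0$ such that \[ \Big\|\sum_k a_ke_k\Big\| = \sup_{n\ge1} t_n\,(a^*_1+\cdots+a^*_n) \quad\text{for every element } \sum_k a_ke_k \in E . \] For $1<p<\infty$, weak $\ell^p$ is the space of all real sequences $a$ tending to $0$ with $\sup_{n\ge1} n^{1/p}a^*_n<\infty$, with the linear topology given by this quasi-norm. Let $C(\omega^\omega)$ be the Banach space, with the supremum norm, of all continuous real-valued functions on the compact space of all ordinals $\le\omega^\omega$ in the order topology ($\omega$ the first infinite ordinal, $\omega^\omega$ the ordinal power). Every Marcinkiewicz sequence space is isomorphic (linearly homeomorphic) to a closed subspace of $C(\omega^\omega)$. In particular, for every $1<p<\infty$, the closed linear span of the unit vectors in weak $\ell^p$ is isomorphic to a closed subspace of $C(\omega^\omega)$. -/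

import Mathlib

open scoped ENNReal Topology

noncomputable section

/-- The decreasing rearrangement `a*` of the sequence `(|a k|)`, with indices starting at `0`:
`a* n` is the least `s ∈ [0, ∞]` such that at most `n` of the numbers `|a k|` exceed `s`.
If `a` tends to `0`, then `a* 0 ≥ a* 1 ≥ ⋯` are the numbers `|a k|` in decreasing order
(followed by zeros if `a` is finitely supported). -/
def decreasingRearrangement (a : ℕ → ℝ) (n : ℕ) : ℝ≥0∞ :=
  sInf {s : ℝ≥0∞ | {k : ℕ | s < ‖a k‖ₑ}.encard ≤ (n : ℕ∞)}

/-- The Banach space `E` with the Schauder basis `e` is the Marcinkiewicz sequence space given by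
the weights `t n` (where `t n` is the weight with number `n + 1` when one counts from `1`):
the weights are strictly positive and decrease to `0`, and
`‖∑ a k • e k‖ = sup_{n ≥ 1} t (n - 1) * (a*_1 + ⋯ + a*_n)` for every element of `E`. -/
structure IsMarcinkiewiczSpace {E : Type*} [NormedAddCommGroup E] [NormedSpace ℝ E]
    (t : ℕ → ℝ) (e : SchauderBasis ℝ E) : Prop where
  pos : ∀ n, 0 < t n
  antitone : Antitone t
  tendsto_zero : Filter.Tendsto t Filter.atTop (𝓝 0)
  enorm_eq : ∀ x : E, ‖x‖ₑ = ⨆ n : ℕ, ENNReal.ofReal (t n) *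
    ∑ i ∈ Finset.range (n + 1), decreasingRearrangement (fun k => e.coord k x) i

/-! ### Weak `ℓ^p` -/

/-- The quasi-norm `sup_{n ≥ 1} n ^ (1 / p) * a*_n` of weak `ℓ^p`, with values in `[0, ∞]`. -/
def weakLpGauge (p : ℝ) (a : ℕ → ℝ) : ℝ≥0∞ :=
  ⨆ n : ℕ, ((n : ℝ≥0∞) + 1) ^ (1 / p) * decreasingRearrangement a n

theorem decreasingRearrangement_add_le (a b : ℕ → ℝ) (m n : ℕ) :
    decreasingRearrangement (a + b) (m + n) ≤
      decreasingRearrangement a m + decreasingRearrangement b n := by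
  have key : ∀ s ∈ {s : ℝ≥0∞ | {k : ℕ | s < ‖a k‖ₑ}.encard ≤ (m : ℕ∞)},
      ∀ s' ∈ {s : ℝ≥0∞ | {k : ℕ | s < ‖b k‖ₑ}.encard ≤ (n : ℕ∞)},
      decreasingRearrangement (a + b) (m + n) ≤ s + s' := by
    intro s hs s' hs'
    apply sInf_le
    have hsub : {k : ℕ | s + s' < ‖(a + b) k‖ₑ} ⊆
        {k : ℕ | s < ‖a k‖ₑ} ∪ {k : ℕ | s' < ‖b k‖ₑ} := by
      intro k hk
      by_contra hcon
      simp only [Set.mem_union, Set.mem_ofPred_eq, not_or, not_lt] at hcon hk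
      exact absurd (hk.trans_le ((enorm_add_le _ _).trans (add_le_add hcon.1 hcon.2)))
        (lt_irrefl _)
    have h1 := (Set.encard_le_encard hsub).trans (Set.encard_union_le _ _)
    have h2 : _ ≤ (m : ℕ∞) + (n : ℕ∞) := h1.trans (add_le_add hs hs')
    simpa using! h2
  rw [decreasingRearrangement.eq_def a m, ENNReal.sInf_add]
  refine le_iInf₂ fun s hs => ?_
  rw [decreasingRearrangement.eq_def b n, add_comm s, ENNReal.sInf_add]
  refine le_iInf₂ fun s' hs' => ?_
  rw [add_comm s']
  exact key s hs s' hs'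

theorem decreasingRearrangement_antitone (a : ℕ → ℝ) :
    Antitone (decreasingRearrangement a) := by
  intro m n hmn
  refine sInf_le_sInf fun s hs => ?_
  exact le_trans (b := (m : ℕ∞)) hs (by exact_mod_cast hmn)

theorem decreasingRearrangement_smul_le (c : ℝ) (a : ℕ → ℝ) (n : ℕ) :
    decreasingRearrangement (c • a) n ≤ ‖c‖ₑ * decreasingRearrangement a n := by
  rcases eq_or_ne c 0 with rfl | hc
  · refine (sInf_le ?_).trans zero_le
    simp
  · unfold decreasingRearrangement
    rw [sInf_eq_iInf (s := {s : ℝ≥0∞ | {k : ℕ | s < ‖a k‖ₑ}.encard ≤ (n : ℕ∞)}),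
      ENNReal.mul_iInf_of_ne (by simpa using hc) enorm_ne_top]
    refine le_iInf fun s => ?_
    rw [ENNReal.mul_iInf_of_ne (by simpa using hc) enorm_ne_top]
    refine le_iInf fun hs => sInf_le ?_
    refine (Set.encard_le_encard ?_).trans hs
    intro k hk
    simp only [Set.mem_ofPred_eq, Pi.smul_apply, smul_eq_mul, enorm_mul] at hk ⊢
    by_contra hcon
    exact absurd (hk.trans_le (mul_le_mul_right (not_lt.mp hcon) _)) (lt_irrefl _)

theorem weakLpGauge_weight_le (r : ℝ) (n : ℕ) :
    ((n : ℝ≥0∞) + 1) ^ r ≤ 2 ^ |r| * (((n / 2 : ℕ) : ℝ≥0∞) + 1) ^ r := by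
  rcases le_total 0 r with hr | hr
  · rw [abs_of_nonneg hr, ← ENNReal.mul_rpow_of_nonneg _ _ hr]
    refine ENNReal.rpow_le_rpow ?_ hr
    have : n + 1 ≤ 2 * (n / 2 + 1) := by omega
    exact_mod_cast this
  · have h1 : ((n : ℝ≥0∞) + 1) ^ r ≤ (((n / 2 : ℕ) : ℝ≥0∞) + 1) ^ r := by
      rw [← neg_neg r, ENNReal.rpow_neg, ENNReal.rpow_neg _ (-r), ENNReal.inv_le_inv]
      refine ENNReal.rpow_le_rpow ?_ (neg_nonneg.mpr hr)
      have : n / 2 + 1 ≤ n + 1 := by omega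
      exact_mod_cast this
    refine h1.trans (le_mul_of_one_le_left' ?_)
    simpa using ENNReal.rpow_le_rpow_of_exponent_le (x := 2) one_le_two (abs_nonneg r)

theorem weakLpGauge_add_le (p : ℝ) (a b : ℕ → ℝ) :
    weakLpGauge p (a + b) ≤ 2 ^ |1 / p| * (weakLpGauge p a + weakLpGauge p b) := by
  refine iSup_le fun n => ?_
  have hR : decreasingRearrangement (a + b) n ≤
      decreasingRearrangement a (n / 2) + decreasingRearrangement b (n / 2) :=
    (decreasingRearrangement_antitone _ (by omega)).trans
      (decreasingRearrangement_add_le a b (n / 2) (n / 2))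
  refine (mul_le_mul' (weakLpGauge_weight_le (1 / p) n) hR).trans ?_
  rw [mul_assoc, mul_add]
  gcongr
  · exact le_iSup (fun n : ℕ => ((n : ℝ≥0∞) + 1) ^ (1 / p) * decreasingRearrangement a n) (n / 2)
  · exact le_iSup (fun n : ℕ => ((n : ℝ≥0∞) + 1) ^ (1 / p) * decreasingRearrangement b n) (n / 2)

theorem weakLpGauge_smul_le (p : ℝ) (c : ℝ) (a : ℕ → ℝ) :
    weakLpGauge p (c • a) ≤ ‖c‖ₑ * weakLpGauge p a := by
  unfold weakLpGauge
  rw [ENNReal.mul_iSup]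
  refine iSup_mono fun n => ?_
  rw [mul_left_comm]
  gcongr
  exact decreasingRearrangement_smul_le c a n

theorem decreasingRearrangement_single (k n : ℕ) :
    decreasingRearrangement (Pi.single k 1) n ≤ if n = 0 then 1 else 0 := by
  refine sInf_le ?_
  split_ifs with hn
  · subst hn
    have : {j : ℕ | (1 : ℝ≥0∞) < ‖(Pi.single k 1 : ℕ → ℝ) j‖ₑ} = ∅ := by
      ext j
      rcases eq_or_ne j k with rfl | hj <;> simp [*]
    simp [this]
  · have : {j : ℕ | (0 : ℝ≥0∞) < ‖(Pi.single k 1 : ℕ → ℝ) j‖ₑ} ⊆ {k} := by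
      intro j hj
      by_contra hne
      simp [Pi.single_eq_of_ne (show j ≠ k from hne)] at hj
    refine (Set.encard_le_encard this).trans ?_
    rw [Set.encard_singleton]
    exact_mod_cast Nat.one_le_iff_ne_zero.mpr hn

theorem weakLpGauge_single_lt_top (p : ℝ) (k : ℕ) :
    weakLpGauge p (Pi.single k 1) < ∞ := by
  refine lt_of_le_of_lt (b := 1) (iSup_le fun n => ?_) ENNReal.one_lt_top
  refine (mul_le_mul_right (decreasingRearrangement_single k n) _).trans ?_
  rcases eq_or_ne n 0 with rfl | hn <;> simp [*]

/-- The sequences `a` with `sup_{n ≥ 1} n ^ (1 / p) * a*_n < ∞`. -/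
def weakLpSubmodule (p : ℝ) : Submodule ℝ (ℕ → ℝ) where
  carrier := {a | weakLpGauge p a < ∞}
  zero_mem' := by
    have h := weakLpGauge_smul_le p 0 0
    rw [zero_smul, enorm_zero, zero_mul] at h
    exact lt_of_le_of_lt h ENNReal.zero_lt_top
  add_mem' {a b} ha hb :=
    lt_of_le_of_lt (weakLpGauge_add_le p a b) (ENNReal.mul_lt_top
      (ENNReal.rpow_lt_top_of_nonneg (abs_nonneg _) ENNReal.ofNat_ne_top)
      (ENNReal.add_lt_top.mpr ⟨ha, hb⟩))
  smul_mem' c a ha :=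
    lt_of_le_of_lt (weakLpGauge_smul_le p c a) (ENNReal.mul_lt_top enorm_lt_top ha)

/-- The space weak `ℓ^p`. It is a type of its own, so that it does not carry the topology of
pointwise convergence. -/
def WeakLp (p : ℝ) : Type := weakLpSubmodule p

namespace WeakLp

instance (p : ℝ) : AddCommGroup (WeakLp p) := inferInstanceAs (AddCommGroup (weakLpSubmodule p))

instance (p : ℝ) : Module ℝ (WeakLp p) := inferInstanceAs (Module ℝ (weakLpSubmodule p))

/-- The sequence underlying an element of weak `ℓ^p`, as a linear map. -/
def toSeq (p : ℝ) : WeakLp p →ₗ[ℝ] (ℕ → ℝ) := (weakLpSubmodule p).subtype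

/-- The quasi-norm of weak `ℓ^p`. -/
def quasiNorm {p : ℝ} (x : WeakLp p) : ℝ≥0∞ := weakLpGauge p (toSeq p x)

theorem quasiNorm_lt_top {p : ℝ} (x : WeakLp p) : quasiNorm x < ∞ := x.2

theorem quasiNorm_add_le {p : ℝ} (x y : WeakLp p) :
    quasiNorm (x + y) ≤ 2 ^ |1 / p| * (quasiNorm x + quasiNorm y) := by
  simpa [quasiNorm] using weakLpGauge_add_le p (toSeq p x) (toSeq p y)

theorem quasiNorm_smul_le {p : ℝ} (c : ℝ) (x : WeakLp p) :
    quasiNorm (c • x) ≤ ‖c‖ₑ * quasiNorm x := by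
  simpa [quasiNorm] using weakLpGauge_smul_le p c (toSeq p x)

theorem quasiNorm_zero {p : ℝ} : quasiNorm (0 : WeakLp p) = 0 := by
  simpa using quasiNorm_smul_le (0 : ℝ) (0 : WeakLp p)

theorem quasiNorm_neg_le {p : ℝ} (x : WeakLp p) : quasiNorm (-x) ≤ quasiNorm x := by
  simpa using quasiNorm_smul_le (-1 : ℝ) x

/-- The balls `{x | quasiNorm x < ε}`, `ε > 0`, as a basis of neighbourhoods of `0`. -/
def ballBasis (p : ℝ) : ModuleFilterBasis ℝ (WeakLp p) where
  sets := {U | ∃ ε : ℝ≥0∞, 0 < ε ∧ U = {x | quasiNorm x < ε}}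
  nonempty := ⟨_, 1, one_pos, rfl⟩
  inter_sets := by
    rintro _ _ ⟨ε, hε, rfl⟩ ⟨δ, hδ, rfl⟩
    exact ⟨_, ⟨min ε δ, lt_min hε hδ, rfl⟩, fun x hx =>
      ⟨lt_of_lt_of_le (b := min ε δ) hx (min_le_left _ _),
        lt_of_lt_of_le (b := min ε δ) hx (min_le_right _ _)⟩⟩
  zero' := by
    rintro _ ⟨ε, hε, rfl⟩
    simpa [quasiNorm_zero] using hε
  add' := by
    rintro _ ⟨ε, hε, rfl⟩
    have hK0 : (2 : ℝ≥0∞) ^ |1 / p| ≠ 0 := by simp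
    have hK : (2 : ℝ≥0∞) ^ |1 / p| ≠ ∞ :=
      (ENNReal.rpow_lt_top_of_nonneg (abs_nonneg _) ENNReal.ofNat_ne_top).ne
    refine ⟨_, ⟨ε / 2 ^ |1 / p| / 2, ?_, rfl⟩, ?_⟩
    · exact ENNReal.div_pos (ENNReal.div_pos hε.ne' hK).ne' ENNReal.ofNat_ne_top
    · rintro _ ⟨x, hx, y, hy, rfl⟩
      refine lt_of_le_of_lt (quasiNorm_add_le x y) ?_
      have h := ENNReal.add_lt_add hx hy
      rw [ENNReal.add_halves] at h
      rw [mul_comm]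
      exact (ENNReal.lt_div_iff_mul_lt (Or.inl hK0) (Or.inl hK)).mp h
  neg' := by
    rintro _ ⟨ε, hε, rfl⟩
    exact ⟨_, ⟨ε, hε, rfl⟩, fun x hx => lt_of_le_of_lt (quasiNorm_neg_le x) hx⟩
  conj' := by
    rintro x₀ _ ⟨ε, hε, rfl⟩
    exact ⟨_, ⟨ε, hε, rfl⟩, fun x hx => by simpa using hx⟩
  smul' := by
    rintro _ ⟨ε, hε, rfl⟩
    refine ⟨Metric.ball 0 1, Metric.ball_mem_nhds _ one_pos, _, ⟨ε, hε, rfl⟩, ?_⟩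
    rintro _ ⟨c, hc, x, hx, rfl⟩
    refine lt_of_le_of_lt ((quasiNorm_smul_le c x).trans ?_) hx
    refine mul_le_of_le_one_left' ?_
    rw [mem_ball_zero_iff] at hc
    rw [← ofReal_norm]
    exact ENNReal.ofReal_le_one.mpr hc.le
  smul_left' := by
    rintro c _ ⟨ε, hε, rfl⟩
    refine ⟨_, ⟨ε / (‖c‖ₑ + 1), ENNReal.div_pos hε.ne' (by simp), rfl⟩, fun x hx => ?_⟩
    have hx' : quasiNorm x < ε / (‖c‖ₑ + 1) := hx
    rw [ENNReal.lt_div_iff_mul_lt (Or.inl (by simp)) (Or.inl (by simp))] at hx'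
    refine lt_of_le_of_lt ((quasiNorm_smul_le c x).trans ?_) hx'
    rw [mul_comm]
    gcongr
    exact le_self_add
  smul_right' := by
    rintro x _ ⟨ε, hε, rfl⟩
    have hc : Filter.Tendsto (fun c : ℝ => ‖c‖ₑ * quasiNorm x) (𝓝 0) (𝓝 (0 * quasiNorm x)) := by
      refine ENNReal.Tendsto.mul_const ?_ (Or.inr (quasiNorm_lt_top x).ne)
      simpa using (continuous_enorm (E := ℝ)).tendsto 0
    rw [zero_mul] at hc
    filter_upwards [hc.eventually (gt_mem_nhds hε)] with c hc
    exact lt_of_le_of_lt (quasiNorm_smul_le c x) hc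

instance (p : ℝ) : TopologicalSpace (WeakLp p) := (ballBasis p).topology

instance (p : ℝ) : IsTopologicalAddGroup (WeakLp p) :=
  (ballBasis p).toAddGroupFilterBasis.isTopologicalAddGroup

instance (p : ℝ) : ContinuousSMul ℝ (WeakLp p) := (ballBasis p).continuousSMul

/-- The unit vector with `1` in position `k` and `0` elsewhere, in weak `ℓ^p`. -/
def unitVector (p : ℝ) (k : ℕ) : WeakLp p := ⟨Pi.single k 1, weakLpGauge_single_lt_top p k⟩

/-- The closed linear span of the unit vectors in weak `ℓ^p`. -/
def unitVectorSpan (p : ℝ) : Submodule ℝ (WeakLp p) :=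
  (Submodule.span ℝ (Set.range (unitVector p))).topologicalClosure

end WeakLp

/-! ### Embeddings and `C(α)` -/

instance compactSpace_Iic_ordinal (α : Ordinal.{0}) : CompactSpace (Set.Iic α) := by
  rw [← isCompact_iff_compactSpace, ← Set.Icc_bot]
  exact isCompact_Icc

/-- The Banach space, with the supremum norm, of the continuous real functions on the compact space
`{β | β ≤ α}` of ordinals with its order topology. -/
abbrev COrdinal (α : Ordinal.{0}) : Type 1 := C(Set.Iic α, ℝ)

/-- `E` is isomorphic (linearly homeomorphic) to a closed subspace of `F`. -/
def EmbedsInto (E F : Type*) [AddCommGroup E] [Module ℝ E] [TopologicalSpace E]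
    [AddCommGroup F] [Module ℝ F] [TopologicalSpace F] : Prop :=
  ∃ S : Submodule ℝ F, IsClosed (S : Set F) ∧ Nonempty (E ≃L[ℝ] S)

end

noncomputable section

/-! ### Finite sets coded by ordinals -/

/-! The norm $\sup_n t_n(a^*_1+\dots+a^*_n)$ is the supremum of $t_n\sum_{k\in F}|a_k|$ over all $n$
and all sets $F$ with at most $n$ elements. Dropping the absolute values costs only a factor 2,
because a finite set splits into the indices with $a_k\ge0$ and those with $a_k<0$. So it suffices
to turn the pairs $(n,F)$ into points of $[0,\omega^\omega]$ at which $a\mapsto t_n\sum_{k\in F}a_k$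
is evaluated, in such a way that the resulting functions are continuous.

Sets with at most $m$ elements are coded by the ordinals in $(0,\omega^m]$: the least element $c$
selects the $c$-th interval of length $\omega^{m-1}$, and the rest, shifted down, is coded inside it
(`exists_codeSet_eq`). Whether $k$ belongs to the coded set is a clopen condition
(`isClopen_setOf_mem_codeSet`). The block $(\omega^n,\omega^{n+1}]$ is a copy of $(0,\omega^{n+1}]$
and carries the weight `t n`. Continuity at $\omega^\omega$, where the blocks accumulate, is what
$t_n\to0$ provides (`continuous_blockEval_single`); density of the finitely supported sequences then
gives continuity for all elements.

The two-sided estimate is `enorm_blockEval_le` and `marcinkiewiczGauge_le_two_mul`. Weak $\ell^p$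
reduces to the weights $n^{1/p-1}$, whose Marcinkiewicz norm is equivalent to the quasi-norm when
$p>1$. -/

theorem isClopen_Ioc_ordinal (a b : Ordinal.{0}) : IsClopen (Set.Ioc a b) := by
  have hIic : ∀ c : Ordinal.{0}, IsClopen (Set.Iic c) := fun c =>
    ⟨isClosed_Iic, by rw [← Order.Iio_succ]; exact isOpen_Iio⟩
  rw [← Set.Ioi_inter_Iic, ← Set.compl_Iic]
  exact (hIic a).compl.inter (hIic b)

theorem continuous_ordinal_sub_right (c : Ordinal.{0}) :
    Continuous fun b : Ordinal.{0} => b - c := by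
  have hlt : ∀ a b : Ordinal.{0}, a < b - c ↔ c + a < b := fun a b => Ordinal.lt_sub
  rw [OrderTopology.continuous_iff]
  intro a
  constructor
  · have : (fun b : Ordinal.{0} => b - c) ⁻¹' Set.Ioi a = Set.Ioi (c + a) := by
      ext b; simp [hlt]
    rw [this]; exact isOpen_Ioi
  -- Subtraction is truncated, so `b - c < a ↔ b < c + a` fails for `a = 0` and `b < c`.
  · rcases eq_or_ne a 0 with rfl | ha
    · have : (fun b : Ordinal.{0} => b - c) ⁻¹' Set.Iio 0 = ∅ := by
        ext b; simp
      rw [this]; exact isOpen_empty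
    · have : (fun b : Ordinal.{0} => b - c) ⁻¹' Set.Iio a = Set.Iio (c + a) := by
        ext b
        simp only [Set.mem_preimage, Set.mem_Iio]
        rcases le_total c b with hcb | hcb
        · rw [← not_le, ← not_le, Ordinal.le_sub_of_le hcb]
        · rw [Ordinal.sub_eq_zero_iff_le.mpr hcb]
          have h0 : 0 < a := pos_iff_ne_zero.mpr ha
          exact ⟨fun _ => hcb.trans_lt (by simpa using (add_lt_add_iff_left c).mpr h0), fun _ => h0⟩
      rw [this]; exact isOpen_Iio

/-- The `c`-th of the consecutive intervals of length `ω ^ n`. -/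
def omegaInterval (n c : ℕ) : Set Ordinal.{0} :=
  Set.Ioc (Ordinal.omega0 ^ n * c) (Ordinal.omega0 ^ n * (c + 1 : ℕ))

theorem omegaInterval_unique {n c d : ℕ} {b : Ordinal.{0}} (hc : b ∈ omegaInterval n c)
    (hd : b ∈ omegaInterval n d) : c = d := by
  have key : ∀ {c d : ℕ}, b ∈ omegaInterval n c → b ∈ omegaInterval n d → c ≤ d := by
    intro c d hc hd
    by_contra! h
    have : Ordinal.omega0 ^ n * ((d + 1 : ℕ) : Ordinal.{0}) ≤ Ordinal.omega0 ^ n * (c : Ordinal) :=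
      mul_le_mul_right (by exact_mod_cast h) _
    exact absurd (hc.1.trans_le (hd.2.trans this)) (lt_irrefl _)
  exact le_antisymm (key hc hd) (key hd hc)

theorem add_mem_omegaInterval {n c : ℕ} {d : Ordinal.{0}} (h0 : 0 < d)
    (hd : d ≤ Ordinal.omega0 ^ n) : Ordinal.omega0 ^ n * c + d ∈ omegaInterval n c := by
  refine ⟨by simpa using (add_lt_add_iff_left (Ordinal.omega0 ^ n * (c : Ordinal.{0}))).mpr h0, ?_⟩
  rw [Nat.cast_succ, mul_add_one]
  exact add_le_add_right hd _

open Classical in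
/-- A finite set of natural numbers coded by an ordinal: the first element of `codeSet (n + 1) b`
is the number `c` of the interval of length `ω ^ n` that contains `b`, and the rest is coded by the
position of `b` in this interval. -/
def codeSet : ℕ → Ordinal.{0} → Finset ℕ
  | 0, _ => ∅
  | n + 1, b =>
    if h : ∃ c : ℕ, b ∈ omegaInterval n c then
      insert h.choose ((codeSet n (b - Ordinal.omega0 ^ n * h.choose)).map
        (addLeftEmbedding (h.choose + 1)))
    else ∅

theorem codeSet_succ_of_mem {n c : ℕ} {b : Ordinal.{0}} (hb : b ∈ omegaInterval n c) :
    codeSet (n + 1) b = insert c ((codeSet n (b - Ordinal.omega0 ^ n * c)).map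
        (addLeftEmbedding (c + 1))) := by
  have h : ∃ c : ℕ, b ∈ omegaInterval n c := ⟨c, hb⟩
  have hc : h.choose = c := omegaInterval_unique h.choose_spec hb
  rw [codeSet, dif_pos h, hc]

theorem codeSet_succ_of_forall_notMem {n : ℕ} {b : Ordinal.{0}}
    (hb : ∀ c, b ∉ omegaInterval n c) : codeSet (n + 1) b = ∅ := by
  rw [codeSet, dif_neg (by simpa using hb)]

theorem card_codeSet_le (n : ℕ) (b : Ordinal.{0}) : (codeSet n b).card ≤ n := by
  induction n generalizing b with
  | zero => simp [codeSet]
  | succ n ih =>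
    by_cases h : ∃ c : ℕ, b ∈ omegaInterval n c
    · obtain ⟨c, hc⟩ := h
      rw [codeSet_succ_of_mem hc]
      refine (Finset.card_insert_le _ _).trans ?_
      simpa using ih _
    · rw [codeSet_succ_of_forall_notMem (by simpa using h)]
      simp

/-- For positive exponent the top point lies beyond every interval of finite number, which makes it
the code of the empty set. -/
theorem codeSet_omega0_pow (n : ℕ) : codeSet n (Ordinal.omega0 ^ n) = ∅ := by
  cases n with
  | zero => simp [codeSet]
  | succ n =>
    refine codeSet_succ_of_forall_notMem fun c hc => absurd hc.2 (not_le.mpr ?_)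
    rw [pow_succ]
    exact mul_lt_mul_of_pos_left (Ordinal.natCast_lt_omega0 _) (pow_pos Ordinal.omega0_pos n)

/-- Induction on `n`: remove the minimum `c` and shift the remaining elements down by `c + 1`.
Positivity of `b` is carried along because the intervals omit their left endpoint. -/
theorem exists_codeSet_eq (n : ℕ) (F : Finset ℕ) (hF : F.card ≤ n) :
    ∃ b : Ordinal.{0}, 0 < b ∧ b ≤ Ordinal.omega0 ^ n ∧ codeSet n b = F := by
  induction n generalizing F with
  | zero =>
    obtain rfl : F = ∅ := by simpa using hF
    exact ⟨1, one_pos, by simp, by simp [codeSet]⟩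
  | succ n ih =>
    rcases F.eq_empty_or_nonempty with rfl | hne
    · exact ⟨_, pow_pos Ordinal.omega0_pos _, le_rfl, codeSet_omega0_pow _⟩
    · set c := F.min' hne with hc
      have hcF : c ∈ F := F.min'_mem hne
      set G : Finset ℕ := (F.erase c).image (fun k => k - (c + 1)) with hG
      have hmap : insert c (G.map (addLeftEmbedding (c + 1))) = F := by
        ext k
        simp only [hG, Finset.mem_insert, Finset.mem_map, Finset.mem_image, Finset.mem_erase,
          addLeftEmbedding_apply]
        have hlt : ∀ j ∈ F, c ≤ j := fun j hj => F.min'_le j hj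
        constructor
        · rintro (rfl | ⟨_, ⟨j, ⟨hj, hjF⟩, rfl⟩, rfl⟩)
          · exact hcF
          · have := hlt j hjF
            rwa [show c + 1 + (j - (c + 1)) = j by omega]
        · intro hk
          rcases eq_or_ne k c with h | h
          · exact Or.inl h
          · have := hlt k hk
            exact Or.inr ⟨k - (c + 1), ⟨k, ⟨h, hk⟩, rfl⟩, by omega⟩
      have hcard : G.card ≤ n := by
        refine Finset.card_image_le.trans ?_
        rw [Finset.card_erase_of_mem hcF]
        omega
      obtain ⟨d, hd0, hd, hdG⟩ := ih G hcard
      have hmem := add_mem_omegaInterval (c := c) hd0 hd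
      refine ⟨_, (bot_le.trans_lt hmem.1), hmem.2.trans ?_, ?_⟩
      · rw [pow_succ]
        exact mul_le_mul_right (Ordinal.natCast_lt_omega0 _).le _
      · rw [codeSet_succ_of_mem hmem, Ordinal.add_sub_cancel, hdG, hmap]

/-- The elements of the coded set are at least its first element `c`, so only the finitely many
intervals with `c ≤ k` matter, and in each only remainders `j < k`. Finiteness of these unions keeps
the set closed as well as open. -/
theorem isClopen_setOf_mem_codeSet (n k : ℕ) : IsClopen {b : Ordinal.{0} | k ∈ codeSet n b} := by
  induction n generalizing k with
  | zero => simp [codeSet, isClopen_empty]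
  | succ n ih =>
    have : {b : Ordinal.{0} | k ∈ codeSet (n + 1) b} =
        ⋃ c ∈ Finset.range (k + 1), omegaInterval n c ∩ {b | k = c ∨
          ∃ j ∈ Finset.range k, c + 1 + j = k ∧ j ∈ codeSet n (b - Ordinal.omega0 ^ n * c)} := by
      ext b
      simp only [Set.mem_ofPred_eq, Set.mem_iUnion, Set.mem_inter_iff, Finset.mem_range]
      constructor
      · intro hk
        by_cases h : ∃ c : ℕ, b ∈ omegaInterval n c
        · obtain ⟨c, hc⟩ := h
          rw [codeSet_succ_of_mem hc] at hk
          simp only [Finset.mem_insert, Finset.mem_map, addLeftEmbedding_apply] at hk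
          rcases hk with hk | ⟨j, hj, hk⟩
          · exact ⟨c, by omega, hc, Or.inl hk⟩
          · exact ⟨c, by omega, hc, Or.inr ⟨j, by omega, hk, hj⟩⟩
        · rw [codeSet_succ_of_forall_notMem (by simpa using h)] at hk
          simp at hk
      · rintro ⟨c, -, hc, hk⟩
        rw [codeSet_succ_of_mem hc]
        simp only [Finset.mem_insert, Finset.mem_map, addLeftEmbedding_apply]
        rcases hk with hk | ⟨j, -, hk, hj⟩
        · exact Or.inl hk
        · exact Or.inr ⟨j, hj, hk⟩
    rw [this]
    refine isClopen_biUnion_finset fun c _ => (isClopen_Ioc_ordinal _ _).inter ?_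
    by_cases hkc : k = c
    · simp [hkc, isClopen_univ]
    · have : {b : Ordinal.{0} | k = c ∨
          ∃ j ∈ Finset.range k, c + 1 + j = k ∧ j ∈ codeSet n (b - Ordinal.omega0 ^ n * c)} =
          ⋃ j ∈ Finset.range k, {b | c + 1 + j = k ∧
            j ∈ codeSet n (b - Ordinal.omega0 ^ n * c)} := by
        ext b
        simp only [hkc, false_or, Set.mem_ofPred_eq, Set.mem_iUnion, exists_prop]
      rw [this]
      refine isClopen_biUnion_finset fun j _ => ?_
      by_cases hj : c + 1 + j = k
      · simpa [hj] using (ih j).preimage (continuous_ordinal_sub_right _)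
      · simp [hj, isClopen_empty]

/-! ### The functions on `[0, ω ^ ω]` given by a sequence -/

/-- The interval `(ω ^ n, ω ^ (n + 1)]`. -/
def omegaBlock (n : ℕ) : Set Ordinal.{0} :=
  Set.Ioc (Ordinal.omega0 ^ n) (Ordinal.omega0 ^ (n + 1))

theorem omegaBlock_unique {m n : ℕ} {b : Ordinal.{0}} (hm : b ∈ omegaBlock m)
    (hn : b ∈ omegaBlock n) : m = n := by
  have key : ∀ {m n : ℕ}, b ∈ omegaBlock m → b ∈ omegaBlock n → m ≤ n := by
    intro m n hm hn
    by_contra! h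
    have : (Ordinal.omega0.{0}) ^ (n + 1) ≤ Ordinal.omega0 ^ m :=
      pow_le_pow_right₀ Ordinal.one_lt_omega0.le h
    exact absurd (hm.1.trans_le (hn.2.trans this)) (lt_irrefl _)
  exact le_antisymm (key hm hn) (key hn hm)

theorem omegaBlock_subset (n : ℕ) : omegaBlock n ⊆ Set.Iic (Ordinal.omega0 ^ Ordinal.omega0) := by
  intro b hb
  refine hb.2.trans ?_
  rw [← Ordinal.opow_natCast]
  exact Ordinal.opow_le_opow_right Ordinal.omega0_pos (Ordinal.natCast_lt_omega0 _).le

/-- In the block `(ω ^ n, ω ^ (n + 1)]` every set of at most `n + 1` numbers is coded. -/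
theorem exists_mem_omegaBlock (n : ℕ) (F : Finset ℕ) (hF : F.card ≤ n + 1) :
    ∃ b ∈ omegaBlock n, codeSet (n + 1) (b - Ordinal.omega0 ^ n) = F := by
  obtain ⟨d, hd0, hd, hdF⟩ := exists_codeSet_eq (n + 1) F hF
  refine ⟨Ordinal.omega0 ^ n + d, ⟨?_, ?_⟩, by rw [Ordinal.add_sub_cancel, hdF]⟩
  · simpa using (add_lt_add_iff_left (Ordinal.omega0.{0} ^ n)).mpr hd0
  -- Absorption: `ω ^ n + ω ^ (n + 1) = ω ^ (n + 1)`.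
  · refine (add_le_add_right hd _).trans_eq ?_
    rw [← Ordinal.opow_natCast, ← Ordinal.opow_natCast]
    exact Ordinal.add_omega0_opow
      ((Ordinal.opow_lt_opow_iff_right Ordinal.one_lt_omega0).mpr (by exact_mod_cast n.lt_succ_self))

open Classical in
/-- The function on the ordinals which takes the value `t n * ∑ k ∈ F, a k` at the point of the
block `(ω ^ n, ω ^ (n + 1)]` which codes the set `F`, and `0` outside of the blocks. -/
def blockEval (t a : ℕ → ℝ) (b : Ordinal.{0}) : ℝ :=
  if h : ∃ n : ℕ, b ∈ omegaBlock n then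
    t h.choose * ∑ k ∈ codeSet (h.choose + 1) (b - Ordinal.omega0 ^ h.choose), a k
  else 0

theorem blockEval_of_mem {n : ℕ} {b : Ordinal.{0}} (hb : b ∈ omegaBlock n) (t a : ℕ → ℝ) :
    blockEval t a b = t n * ∑ k ∈ codeSet (n + 1) (b - Ordinal.omega0 ^ n), a k := by
  have h : ∃ n : ℕ, b ∈ omegaBlock n := ⟨n, hb⟩
  have hn : h.choose = n := omegaBlock_unique h.choose_spec hb
  rw [blockEval, dif_pos h, hn]

theorem blockEval_of_forall_notMem {b : Ordinal.{0}} (hb : ∀ n, b ∉ omegaBlock n) (t a : ℕ → ℝ) :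
    blockEval t a b = 0 := by
  rw [blockEval, dif_neg (by simpa using hb)]

theorem blockEval_add (t a a' : ℕ → ℝ) (b : Ordinal.{0}) :
    blockEval t (a + a') b = blockEval t a b + blockEval t a' b := by
  by_cases h : ∃ n : ℕ, b ∈ omegaBlock n
  · obtain ⟨n, hn⟩ := h
    simp [blockEval_of_mem hn, Finset.sum_add_distrib, mul_add]
  · have h' : ∀ n, b ∉ omegaBlock n := by simpa using h
    simp [blockEval_of_forall_notMem h']

theorem blockEval_smul (t : ℕ → ℝ) (c : ℝ) (a : ℕ → ℝ) (b : Ordinal.{0}) :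
    blockEval t (c • a) b = c * blockEval t a b := by
  by_cases h : ∃ n : ℕ, b ∈ omegaBlock n
  · obtain ⟨n, hn⟩ := h
    simp only [blockEval_of_mem hn, Pi.smul_apply, smul_eq_mul, ← Finset.mul_sum]
    ring
  · have h' : ∀ n, b ∉ omegaBlock n := by simpa using h
    simp [blockEval_of_forall_notMem h']

/-- `blockEval` as a linear map. -/
def blockEvalₗ (t : ℕ → ℝ) : (ℕ → ℝ) →ₗ[ℝ] Ordinal.{0} → ℝ where
  toFun := blockEval t
  map_add' a a' := funext fun b => blockEval_add t a a' b
  map_smul' c a := funext fun b => blockEval_smul t c a b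

theorem continuous_of_forall_exists_abs_sub_lt {X : Type*} [TopologicalSpace X] {f : X → ℝ}
    (h : ∀ ε > 0, ∃ g : X → ℝ, Continuous g ∧ ∀ x, |f x - g x| < ε) : Continuous f := by
  refine continuous_of_uniform_approx_of_continuous fun u hu => ?_
  obtain ⟨ε, hε, hu⟩ := Metric.mem_uniformity_dist.mp hu
  obtain ⟨g, hg, hfg⟩ := h ε hε
  exact ⟨g, hg, fun x => hu (by rw [Real.dist_eq]; exact hfg x)⟩

/-- The function equals `t n` on a clopen subset `B n` of each block and `0` elsewhere. Since `t`
decreases to `0`, it is the uniform limit of the finite sums over the first blocks. -/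
theorem continuous_blockEval_single {t : ℕ → ℝ} (h0 : ∀ n, 0 < t n) (ht : Antitone t)
    (hlim : Filter.Tendsto t Filter.atTop (𝓝 0)) (k : ℕ) :
    Continuous (blockEval t (Pi.single k 1)) := by
  classical
  set B : ℕ → Set Ordinal.{0} := fun n =>
    omegaBlock n ∩ {b | k ∈ codeSet (n + 1) (b - Ordinal.omega0 ^ n)} with hB
  have hBc : ∀ n, IsClopen (B n) := fun n => (isClopen_Ioc_ordinal _ _).inter
    ((isClopen_setOf_mem_codeSet (n + 1) k).preimage (continuous_ordinal_sub_right _))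
  refine continuous_of_forall_exists_abs_sub_lt fun ε hε => ?_
  obtain ⟨N, hN⟩ := (hlim.eventually (gt_mem_nhds hε)).exists
  refine ⟨fun b => ∑ n ∈ Finset.range N, (B n).indicator (fun _ => t n) b,
    continuous_finsetSum _ fun n _ => continuous_const.indicator (by simp [(hBc n).frontier_eq]),
    fun b => ?_⟩
  beta_reduce
  by_cases h : ∃ m : ℕ, b ∈ omegaBlock m
  · obtain ⟨m, hm⟩ := h
    have hsingle : ∀ n, n ≠ m → (B n).indicator (fun _ => t n) b = 0 := fun n hn =>
      Set.indicator_of_notMem (fun hb => hn (omegaBlock_unique hb.1 hm)) _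
    have hval : blockEval t (Pi.single k 1) b = (B m).indicator (fun _ => t m) b := by
      rw [blockEval_of_mem hm]
      simp only [Pi.single_apply, Finset.sum_ite_eq']
      by_cases hk : k ∈ codeSet (m + 1) (b - Ordinal.omega0 ^ m)
      · rw [Set.indicator_of_mem (show b ∈ B m from ⟨hm, hk⟩), if_pos hk, mul_one]
      · rw [Set.indicator_of_notMem (fun hb : b ∈ B m => hk hb.2), if_neg hk, mul_zero]
    rw [hval]
    by_cases hmN : m < N
    · rw [Finset.sum_eq_single_of_mem m (Finset.mem_range.mpr hmN) fun n _ hn => hsingle n hn]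
      simpa using hε
    · rw [Finset.sum_eq_zero fun n hn => hsingle n (by have := Finset.mem_range.mp hn; omega),
        sub_zero]
      refine lt_of_le_of_lt ?_ ((ht (not_lt.mp hmN)).trans_lt hN)
      by_cases hb : b ∈ B m
      · rw [Set.indicator_of_mem hb, abs_of_pos (h0 m)]
      · rw [Set.indicator_of_notMem hb, abs_zero]
        exact (h0 m).le
  · have h' : ∀ n, b ∉ omegaBlock n := by simpa using h
    rw [blockEval_of_forall_notMem h', Finset.sum_eq_zero fun n _ =>
      Set.indicator_of_notMem (fun hb : b ∈ B n => h' n hb.1) _]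
    simpa using hε

theorem continuous_blockEval_of_mem_span {t : ℕ → ℝ} (h0 : ∀ n, 0 < t n) (ht : Antitone t)
    (hlim : Filter.Tendsto t Filter.atTop (𝓝 0)) {a : ℕ → ℝ}
    (ha : a ∈ Submodule.span ℝ (Set.range fun k : ℕ => (Pi.single k 1 : ℕ → ℝ))) :
    Continuous (blockEval t a) := by
  induction ha using Submodule.span_induction with
  | mem a ha =>
    obtain ⟨k, rfl⟩ := ha
    exact continuous_blockEval_single h0 ht hlim k
  | zero =>
    rw [show blockEval t 0 = 0 from map_zero (blockEvalₗ t)]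
    exact continuous_const
  | add a a' _ _ h h' => rw [funext (blockEval_add t a a')]; exact h.add h'
  | smul c a _ h => rw [funext (blockEval_smul t c a)]; exact continuous_const.mul h

/-! ### Sums of decreasing rearrangements -/

/-- Induction removing the smallest term: if `m + 1` entries are all at least `‖a k‖ₑ`, no `s` below
`‖a k‖ₑ` is admissible in the infimum defining `a* m`. -/
theorem sum_enorm_le_sum_decreasingRearrangement (a : ℕ → ℝ) (F : Finset ℕ) :
    ∑ k ∈ F, ‖a k‖ₑ ≤ ∑ i ∈ Finset.range F.card, decreasingRearrangement a i := by
  obtain ⟨m, hm⟩ : ∃ m, F.card = m := ⟨_, rfl⟩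
  induction m generalizing F with
  | zero =>
    obtain rfl : F = ∅ := by simpa using hm
    simp
  | succ m ih =>
    have hne : F.Nonempty := by rw [← Finset.card_pos]; omega
    obtain ⟨k, hk, hmin⟩ := F.exists_min_image (fun k => ‖a k‖ₑ) hne
    have hcard : (F.erase k).card = m := by rw [Finset.card_erase_of_mem hk]; omega
    have hle : ‖a k‖ₑ ≤ decreasingRearrangement a m := by
      refine le_sInf fun s hs => ?_
      by_contra! hlt
      have hsub : (F : Set ℕ) ⊆ {k : ℕ | s < ‖a k‖ₑ} := fun j hj => hlt.trans_le (hmin j hj)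
      have h := (Set.encard_le_encard hsub).trans hs
      rw [Set.encard_coe_eq_coe_finsetCard, hm] at h
      have : m + 1 ≤ m := by exact_mod_cast h
      omega
    rw [hm, Finset.sum_range_succ, ← Finset.sum_erase_add _ _ hk]
    have := ih (F.erase k) hcard
    rw [hcard] at this
    exact add_le_add this hle

/-- Greedy choice. The factor `c < 1` is needed because `a` is not assumed to tend to `0`, so the
values of the rearrangement need not be attained. -/
theorem exists_mul_sum_decreasingRearrangement_le (a : ℕ → ℝ)
    (hfin : decreasingRearrangement a 0 ≠ ∞) {c : ℝ≥0∞} (hc : c < 1) (n : ℕ) :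
    ∃ F : Finset ℕ, F.card ≤ n ∧
      c * ∑ i ∈ Finset.range n, decreasingRearrangement a i ≤ ∑ k ∈ F, ‖a k‖ₑ := by
  induction n with
  | zero => exact ⟨∅, by simp⟩
  | succ n ih =>
    obtain ⟨F, hF, hle⟩ := ih
    rw [Finset.sum_range_succ, mul_add]
    by_cases h0 : decreasingRearrangement a n = 0
    · exact ⟨F, by omega, by simpa [h0] using hle⟩
    · have hne : decreasingRearrangement a n ≠ ∞ :=
        ne_top_of_le_ne_top hfin (decreasingRearrangement_antitone a n.zero_le)
      have hlt : c * decreasingRearrangement a n < decreasingRearrangement a n := by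
        simpa using ENNReal.mul_lt_mul_left h0 hne hc
      -- More than `n` entries exceed `c * a* n`, so one of them lies outside `F`.
      have hcard : ¬ {k : ℕ | c * decreasingRearrangement a n < ‖a k‖ₑ}.encard ≤ (n : ℕ∞) :=
        fun h => absurd hlt (not_lt.mpr (sInf_le h))
      obtain ⟨k, hk, hkF⟩ : ∃ k, c * decreasingRearrangement a n < ‖a k‖ₑ ∧ k ∉ F := by
        by_contra! hcon
        refine hcard ((Set.encard_le_encard (t := (F : Set ℕ)) fun k hk => hcon k hk).trans ?_)
        rw [Set.encard_coe_eq_coe_finsetCard]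
        exact_mod_cast hF
      refine ⟨insert k F, (Finset.card_insert_le _ _).trans (by omega), ?_⟩
      rw [Finset.sum_insert hkF, add_comm]
      exact add_le_add hk.le hle

theorem sum_decreasingRearrangement_le (a : ℕ → ℝ) (n : ℕ) (B : ℝ≥0∞)
    (h : ∀ F : Finset ℕ, F.card ≤ n → ∑ k ∈ F, ‖a k‖ₑ ≤ B) :
    ∑ i ∈ Finset.range n, decreasingRearrangement a i ≤ B := by
  rcases eq_or_ne B ∞ with rfl | hB
  · exact le_top
  rcases n.eq_zero_or_pos with rfl | hn
  · simp
  -- Singletons bound every entry, hence also `a* 0`; this supplies the finiteness needed before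
  -- letting `c` tend to `1`.
  have hk : ∀ k, ‖a k‖ₑ ≤ B := fun k => by simpa using h {k} (by rw [Finset.card_singleton]; omega)
  have hfin : decreasingRearrangement a 0 ≠ ∞ := by
    refine ne_top_of_le_ne_top hB (sInf_le ?_)
    have : {k : ℕ | B < ‖a k‖ₑ} = ∅ := by
      ext k; simpa using hk k
    simp [this]
  refine ENNReal.le_of_forall_lt_one_mul_le fun c hc => ?_
  obtain ⟨F, hF, hle⟩ := exists_mul_sum_decreasingRearrangement_le a hfin hc n
  exact hle.trans (h F hF)

/-- On the indices of one sign the sum of absolute values is the absolute value of the sum. -/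
theorem sum_enorm_le_two_mul (a : ℕ → ℝ) (F : Finset ℕ) (C : ℝ≥0∞)
    (h : ∀ G ⊆ F, ‖∑ k ∈ G, a k‖ₑ ≤ C) : ∑ k ∈ F, ‖a k‖ₑ ≤ 2 * C := by
  classical
  have hpos : ∑ k ∈ F with 0 ≤ a k, ‖a k‖ₑ ≤ C := by
    refine le_trans (le_of_eq ?_) (h _ (Finset.filter_subset (fun k => 0 ≤ a k) F))
    rw [Real.enorm_of_nonneg (Finset.sum_nonneg fun k hk => (Finset.mem_filter.mp hk).2),
      ENNReal.ofReal_sum_of_nonneg fun k hk => (Finset.mem_filter.mp hk).2]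
    exact Finset.sum_congr rfl fun k hk => Real.enorm_of_nonneg (Finset.mem_filter.mp hk).2
  have hneg : ∑ k ∈ F with ¬ 0 ≤ a k, ‖a k‖ₑ ≤ C := by
    refine le_trans (le_of_eq ?_) (h _ (Finset.filter_subset (fun k => ¬ 0 ≤ a k) F))
    have h' : ∀ k ∈ F.filter (fun k => ¬ 0 ≤ a k), 0 ≤ - a k := fun k hk => by
      have := (Finset.mem_filter.mp hk).2
      linarith
    rw [← enorm_neg (∑ k ∈ _, a k), ← Finset.sum_neg_distrib,
      Real.enorm_of_nonneg (Finset.sum_nonneg h'), ENNReal.ofReal_sum_of_nonneg h']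
    exact Finset.sum_congr rfl fun k hk => by rw [← enorm_neg, Real.enorm_of_nonneg (h' k hk)]
  rw [← Finset.sum_filter_add_sum_filter_not F (fun k => 0 ≤ a k), two_mul]
  exact add_le_add hpos hneg

/-- The Marcinkiewicz norm of a sequence, with values in `[0, ∞]`. -/
def marcinkiewiczGauge (t a : ℕ → ℝ) : ℝ≥0∞ :=
  ⨆ n : ℕ, ENNReal.ofReal (t n) * ∑ i ∈ Finset.range (n + 1), decreasingRearrangement a i

theorem enorm_blockEval_le (t a : ℕ → ℝ) (h0 : ∀ n, 0 < t n) (b : Ordinal.{0}) :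
    ‖blockEval t a b‖ₑ ≤ marcinkiewiczGauge t a := by
  by_cases h : ∃ n : ℕ, b ∈ omegaBlock n
  · obtain ⟨n, hn⟩ := h
    rw [blockEval_of_mem hn, enorm_mul, Real.enorm_of_nonneg (h0 n).le]
    refine le_trans ?_ (le_iSup (fun n : ℕ => ENNReal.ofReal (t n) *
      ∑ i ∈ Finset.range (n + 1), decreasingRearrangement a i) n)
    gcongr
    refine (enorm_sum_le _ _).trans ((sum_enorm_le_sum_decreasingRearrangement a _).trans ?_)
    exact Finset.sum_le_sum_of_subset (Finset.range_mono (card_codeSet_le _ _))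
  · rw [blockEval_of_forall_notMem (by simpa using h)]
    simp

/-- Block `n` codes every subset of a set `F` with at most `n + 1` elements, so the sign splitting
applies to `F`. -/
theorem marcinkiewiczGauge_le_two_mul (t a : ℕ → ℝ) (h0 : ∀ n, 0 < t n) (C : ℝ≥0∞)
    (h : ∀ b ∈ Set.Iic (Ordinal.omega0.{0} ^ Ordinal.omega0), ‖blockEval t a b‖ₑ ≤ C) :
    marcinkiewiczGauge t a ≤ 2 * C := by
  refine iSup_le fun n => ?_
  have ht0 : ENNReal.ofReal (t n) ≠ 0 := by simpa using h0 n
  rw [mul_comm, ← ENNReal.le_div_iff_mul_le (Or.inl ht0) (Or.inl ENNReal.ofReal_ne_top)]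
  refine sum_decreasingRearrangement_le a _ _ fun F hF => ?_
  rw [mul_div_assoc]
  refine sum_enorm_le_two_mul a F _ fun G hG => ?_
  obtain ⟨b, hb, hbG⟩ := exists_mem_omegaBlock n G ((Finset.card_le_card hG).trans hF)
  have := h b (omegaBlock_subset n hb)
  rw [blockEval_of_mem hb, hbG, enorm_mul, Real.enorm_of_nonneg (h0 n).le] at this
  rwa [ENNReal.le_div_iff_mul_le (Or.inl ht0) (Or.inl ENNReal.ofReal_ne_top), mul_comm]

/-! ### The embedding of a space of sequences into `C(ω ^ ω)` -/

theorem continuous_blockEval_of_approx {t : ℕ → ℝ} (h0 : ∀ n, 0 < t n) (ht : Antitone t)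
    (hlim : Filter.Tendsto t Filter.atTop (𝓝 0)) {a : ℕ → ℝ}
    (ha : ∀ ε : ℝ≥0∞, 0 < ε →
      ∃ a' ∈ Submodule.span ℝ (Set.range fun k : ℕ => (Pi.single k 1 : ℕ → ℝ)),
        marcinkiewiczGauge t (a - a') < ε) :
    Continuous (blockEval t a) := by
  refine continuous_of_forall_exists_abs_sub_lt fun ε hε => ?_
  obtain ⟨a', ha', hlt⟩ := ha (ENNReal.ofReal ε) (ENNReal.ofReal_pos.mpr hε)
  refine ⟨_, continuous_blockEval_of_mem_span h0 ht hlim ha', fun b => ?_⟩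
  have hsub : blockEval t (a - a') b = blockEval t a b - blockEval t a' b :=
    congrFun (map_sub (blockEvalₗ t) a a') b
  have h := (enorm_blockEval_le t (a - a') h0 b).trans_lt hlt
  rwa [hsub, ← ofReal_norm, ENNReal.ofReal_lt_ofReal_iff hε, Real.norm_eq_abs] at h

/-- The linear map into `C(ω ^ ω)` given by the functions `blockEval t (L x)`. -/
def blockMap {V : Type*} [AddCommGroup V] [Module ℝ V] (t : ℕ → ℝ) (L : V →ₗ[ℝ] ℕ → ℝ)
    (hL : ∀ x, Continuous (blockEval t (L x))) :
    V →ₗ[ℝ] COrdinal (Ordinal.omega0 ^ Ordinal.omega0) where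
  toFun x := ⟨fun b => blockEval t (L x) b, (hL x).comp continuous_subtype_val⟩
  map_add' x y := by ext b; simp [blockEval_add]
  map_smul' c x := by ext b; simp [blockEval_smul]

theorem enorm_le_of_forall_enorm_apply_le {α : Ordinal.{0}} (f : COrdinal α) (C : ℝ≥0∞)
    (h : ∀ b, ‖f b‖ₑ ≤ C) : ‖f‖ₑ ≤ C := by
  rcases eq_or_ne C ∞ with rfl | hC
  · exact le_top
  rw [← ofReal_norm]
  refine ENNReal.ofReal_le_of_le_toReal ((ContinuousMap.norm_le f ENNReal.toReal_nonneg).mpr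
    fun b => ?_)
  have := ENNReal.toReal_mono hC (h b)
  rwa [toReal_enorm] at this

theorem enorm_apply_le_enorm {α : Ordinal.{0}} (f : COrdinal α) (b) : ‖f b‖ₑ ≤ ‖f‖ₑ := by
  rw [← ofReal_norm, ← ofReal_norm]
  exact ENNReal.ofReal_le_ofReal (f.norm_coe_le_norm b)

section blockMap

variable {V : Type*} [AddCommGroup V] [Module ℝ V] {t : ℕ → ℝ} {L : V →ₗ[ℝ] ℕ → ℝ}
  (hL : ∀ x, Continuous (blockEval t (L x)))

theorem enorm_blockMap_le (h0 : ∀ n, 0 < t n) (x : V) :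
    ‖blockMap t L hL x‖ₑ ≤ marcinkiewiczGauge t (L x) :=
  enorm_le_of_forall_enorm_apply_le _ _ fun b => enorm_blockEval_le t (L x) h0 b

theorem marcinkiewiczGauge_le_of_forall_eq (h0 : ∀ n, 0 < t n) (a : ℕ → ℝ)
    (f : COrdinal (Ordinal.omega0 ^ Ordinal.omega0)) (hf : ∀ b, f b = blockEval t a b) :
    marcinkiewiczGauge t a ≤ 2 * ‖f‖ₑ := by
  refine marcinkiewiczGauge_le_two_mul t a h0 _ fun b hb => ?_
  rw [← hf ⟨b, hb⟩]
  exact enorm_apply_le_enorm f _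

theorem marcinkiewiczGauge_le_blockMap (h0 : ∀ n, 0 < t n) (x : V) :
    marcinkiewiczGauge t (L x) ≤ 2 * ‖blockMap t L hL x‖ₑ :=
  marcinkiewiczGauge_le_of_forall_eq h0 _ _ fun _ => rfl

end blockMap

/-- Functions in the closure of a set of functions `blockEval t a` are of this form. -/
theorem exists_eq_blockEval_of_mem_closure {t : ℕ → ℝ} (h0 : ∀ n, 0 < t n)
    {S : Set (COrdinal (Ordinal.omega0 ^ Ordinal.omega0))}
    (hS : ∀ f ∈ S, ∃ a : ℕ → ℝ, ∀ b, f b = blockEval t a b)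
    {f : COrdinal (Ordinal.omega0 ^ Ordinal.omega0)} (hf : f ∈ closure S) :
    ∃ a : ℕ → ℝ, ∀ b, f b = blockEval t a b := by
  -- Block `0` codes all singletons, so `a k` is recovered as `f (β k) / t 0`, continuously in `f`.
  -- At each `b` the desired identity involves finitely many coordinates and is therefore a closed
  -- condition on `f`.
  choose β hβ hβk using fun k : ℕ => exists_mem_omegaBlock 0 {k} (by simp)
  set R : COrdinal (Ordinal.omega0 ^ Ordinal.omega0) → ℕ → ℝ := fun f k =>
    (t 0)⁻¹ * f ⟨β k, omegaBlock_subset 0 (hβ k)⟩ with hR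
  have hRc : ∀ k, Continuous fun f => R f k := fun k =>
    continuous_const.mul (continuous_eval_const _)
  refine ⟨R f, fun b => ?_⟩
  have hclosed : IsClosed {f : COrdinal (Ordinal.omega0 ^ Ordinal.omega0) |
      f b = blockEval t (R f) b} := by
    refine isClosed_eq (continuous_eval_const b) ?_
    by_cases h : ∃ n : ℕ, (b : Ordinal.{0}) ∈ omegaBlock n
    · obtain ⟨n, hn⟩ := h
      simp only [blockEval_of_mem hn]
      exact continuous_const.mul (continuous_finsetSum _ fun k _ => hRc k)
    · have h' : ∀ n, (b : Ordinal.{0}) ∉ omegaBlock n := by simpa using h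
      simp only [blockEval_of_forall_notMem h']
      exact continuous_const
  refine closure_minimal (fun g hg => ?_) hclosed hf
  obtain ⟨a, ha⟩ := hS g hg
  have : R g = a := by
    funext k
    simp only [hR]
    rw [ha, blockEval_of_mem (hβ k), zero_add]
    have := hβk k
    rw [zero_add] at this
    rw [this, Finset.sum_singleton, inv_mul_cancel_left₀ (h0 0).ne']
  simp only [Set.mem_ofPred_eq, this, ha]

theorem IsMarcinkiewiczSpace.embedsInto {E : Type*} [NormedAddCommGroup E] [NormedSpace ℝ E]
    [CompleteSpace E] {t : ℕ → ℝ} {e : SchauderBasis ℝ E} (h : IsMarcinkiewiczSpace t e) :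
    EmbedsInto E (COrdinal (Ordinal.omega0 ^ Ordinal.omega0)) := by
  set L : E →ₗ[ℝ] ℕ → ℝ := LinearMap.pi fun k => (e.coord k : E →ₗ[ℝ] ℝ) with hLdef
  have hgauge : ∀ x, ‖x‖ₑ = marcinkiewiczGauge t (L x) := h.enorm_eq
  have hsingle : ∀ k, L (e k) = Pi.single k 1 := fun k => funext fun j => by
    convert e.ortho j k <;> rfl
  have hL : ∀ x, Continuous (blockEval t (L x)) := by
    intro x
    refine continuous_blockEval_of_approx h.pos h.antitone h.tendsto_zero fun ε hε => ?_
    -- The basis expansion approximates `x` by finite combinations of the `e k`, and the gauge of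
    -- the error is its norm.
    have hlim : Filter.Tendsto (fun n => ‖x - SchauderBasis.proj e n x‖ₑ) Filter.atTop (𝓝 0) := by
      have := (tendsto_const_nhds (x := x)).sub (SchauderBasis.tendsto_proj e x)
      rw [sub_self] at this
      simpa using this.enorm
    obtain ⟨n, hn⟩ := (hlim.eventually (gt_mem_nhds hε)).exists
    refine ⟨L (SchauderBasis.proj e n x), ?_, by rwa [← map_sub, ← hgauge]⟩
    rw [SchauderBasis.proj_apply, map_sum]
    refine Submodule.sum_mem _ fun k _ => ?_
    rw [map_smul, hsingle]
    exact Submodule.smul_mem _ _ (Submodule.subset_span ⟨k, rfl⟩)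
  set T := (blockMap t L hL).mkContinuous 1 (fun x => by
    have := enorm_blockMap_le hL h.pos x
    rw [← hgauge, ← ofReal_norm, ← ofReal_norm,
      ENNReal.ofReal_le_ofReal_iff (norm_nonneg _)] at this
    rwa [one_mul]) with hT
  have hanti : AntilipschitzWith 2 T := by
    refine AddMonoidHomClass.antilipschitz_of_bound T fun x => ?_
    have := marcinkiewiczGauge_le_blockMap hL h.pos x
    rw [← hgauge, ← ofReal_norm, ← ofReal_norm, ← ENNReal.ofReal_ofNat 2,
      ← ENNReal.ofReal_mul (by norm_num), ENNReal.ofReal_le_ofReal_iff (by positivity)] at this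
    exact this
  have hclosed : IsClosed (Set.range T) := hanti.isClosed_range T.uniformContinuous
  exact ⟨_, by rwa [LinearMap.coe_range], ⟨T.equivRange hanti.injective hclosed⟩⟩

/-! ### Weak `ℓ^p` as a Marcinkiewicz space -/

/-- Induction on `n`. Bernoulli's inequality with exponent `1 - s ≤ 1` at `-1 / (n + 1)`, multiplied
by `(n + 1) ^ (1 - s)`, reads `n ^ (1 - s) + (1 - s) * (n + 1) ^ (-s) ≤ (n + 1) ^ (1 - s)`. -/
theorem sum_range_rpow_neg_le {s : ℝ} (h0 : 0 < s) (h1 : s < 1) (n : ℕ) :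
    ∑ i ∈ Finset.range n, ((i : ℝ) + 1) ^ (-s) ≤ (1 - s)⁻¹ * (n : ℝ) ^ (1 - s) := by
  have hs : 0 < 1 - s := by linarith
  induction n with
  | zero => simp [Real.zero_rpow hs.ne']
  | succ n ih =>
    have hn : (0 : ℝ) < n + 1 := by positivity
    have hbern := rpow_one_add_le_one_add_mul_self (s := -(1 / ((n : ℝ) + 1)))
      (by rw [neg_le_neg_iff, div_le_one hn]; linarith [(n.cast_nonneg : (0 : ℝ) ≤ n)])
      hs.le (by linarith : 1 - s ≤ 1)
    have hq : 1 + -(1 / ((n : ℝ) + 1)) = n / (n + 1) := by field_simp; ring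
    rw [hq, Real.div_rpow n.cast_nonneg hn.le, div_le_iff₀ (Real.rpow_pos_of_pos hn _)] at hbern
    have hneg : ((n : ℝ) + 1) ^ (-s) = ((n : ℝ) + 1) ^ (1 - s) / (n + 1) := by
      rw [← Real.rpow_sub_one hn.ne']; ring_nf
    rw [Finset.sum_range_succ]
    refine (add_le_add_left ih _).trans ?_
    rw [hneg, Nat.cast_succ, inv_mul_eq_div, inv_mul_eq_div, le_div_iff₀ hs, add_mul,
      div_mul_cancel₀ _ hs.ne']
    refine (add_le_add_left hbern _).trans (le_of_eq ?_)
    ring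

theorem ofReal_natCast_add_one_rpow (n : ℕ) (r : ℝ) :
    ENNReal.ofReal (((n : ℝ) + 1) ^ r) = ((n : ℝ≥0∞) + 1) ^ r := by
  rw [← ENNReal.ofReal_rpow_of_pos (by positivity), ENNReal.ofReal_add (by positivity) one_pos.le,
    ENNReal.ofReal_natCast, ENNReal.ofReal_one]

/-- The weights of weak `ℓ^p`. -/
def weakLpWeight (p : ℝ) (n : ℕ) : ℝ := ((n : ℝ) + 1) ^ (1 / p - 1)

theorem weakLpWeight_pos {p : ℝ} (n : ℕ) : 0 < weakLpWeight p n :=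
  Real.rpow_pos_of_pos (by positivity) _

theorem antitone_weakLpWeight {p : ℝ} (hp : 1 < p) : Antitone (weakLpWeight p) := by
  intro m n hmn
  have : 1 / p < 1 := (div_lt_one (by linarith)).mpr hp
  refine Real.rpow_le_rpow_of_nonpos (by positivity) ?_ (by linarith)
  exact_mod_cast Nat.succ_le_succ hmn

theorem tendsto_weakLpWeight {p : ℝ} (hp : 1 < p) :
    Filter.Tendsto (weakLpWeight p) Filter.atTop (𝓝 0) := by
  have : 1 / p < 1 := (div_lt_one (by linarith)).mpr hp
  have h := (tendsto_rpow_neg_atTop (y := 1 - 1 / p) (by linarith)).comp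
    (Filter.tendsto_atTop_add_const_right _ (1 : ℝ) tendsto_natCast_atTop_atTop)
  refine h.congr fun n => ?_
  simp only [Function.comp_apply, weakLpWeight, neg_sub]

/-- A term of a decreasing sequence is at most the average of the terms up to it. -/
theorem weakLpGauge_le_marcinkiewiczGauge (p : ℝ) (a : ℕ → ℝ) :
    weakLpGauge p a ≤ marcinkiewiczGauge (weakLpWeight p) a := by
  refine iSup_mono fun n => ?_
  have hsum : ((n : ℝ≥0∞) + 1) * decreasingRearrangement a n ≤
      ∑ i ∈ Finset.range (n + 1), decreasingRearrangement a i := by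
    have := Finset.card_nsmul_le_sum (Finset.range (n + 1)) (decreasingRearrangement a)
      (decreasingRearrangement a n) fun i hi =>
        decreasingRearrangement_antitone a (by have := Finset.mem_range.mp hi; omega)
    simpa using this
  refine le_trans (le_of_eq ?_) (mul_le_mul_right hsum _)
  rw [← mul_assoc, weakLpWeight, ofReal_natCast_add_one_rpow]
  congr 1
  nth_rewrite 3 [← ENNReal.rpow_one ((n : ℝ≥0∞) + 1)]
  rw [← ENNReal.rpow_add _ _ (by simp) (by simp)]
  ring_nf

/-- Sum the bounds `a* i ≤ (i + 1) ^ (-1 / p) * weakLpGauge p a`; the power sum converts the weight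
exactly into the constant `(1 - 1 / p)⁻¹`. -/
theorem marcinkiewiczGauge_le_weakLpGauge {p : ℝ} (hp : 1 < p) (a : ℕ → ℝ) :
    marcinkiewiczGauge (weakLpWeight p) a ≤
      ENNReal.ofReal (1 - 1 / p)⁻¹ * weakLpGauge p a := by
  have h0 : 0 < 1 / p := by positivity
  have h1 : 1 / p < 1 := (div_lt_one (by linarith)).mpr hp
  refine iSup_le fun n => ?_
  have hterm : ∀ i, decreasingRearrangement a i ≤
      ENNReal.ofReal (((i : ℝ) + 1) ^ (-(1 / p))) * weakLpGauge p a := by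
    intro i
    have h := le_iSup (fun n : ℕ => ((n : ℝ≥0∞) + 1) ^ (1 / p) * decreasingRearrangement a n) i
    rw [ofReal_natCast_add_one_rpow]
    refine le_trans (le_of_eq ?_) (mul_le_mul_right h _)
    rw [← mul_assoc, ← ENNReal.rpow_add _ _ (by simp) (by simp)]
    simp
  calc ENNReal.ofReal (weakLpWeight p n) *
        ∑ i ∈ Finset.range (n + 1), decreasingRearrangement a i
      ≤ ENNReal.ofReal (weakLpWeight p n) * ∑ i ∈ Finset.range (n + 1),
          ENNReal.ofReal (((i : ℝ) + 1) ^ (-(1 / p))) * weakLpGauge p a := by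
        gcongr with i; exact hterm i
    _ = ENNReal.ofReal (weakLpWeight p n *
          ∑ i ∈ Finset.range (n + 1), ((i : ℝ) + 1) ^ (-(1 / p))) * weakLpGauge p a := by
        rw [← Finset.sum_mul, ← ENNReal.ofReal_sum_of_nonneg fun i _ => by positivity, ← mul_assoc,
          ← ENNReal.ofReal_mul (weakLpWeight_pos n).le]
    _ ≤ _ := by
        gcongr
        refine (mul_le_mul_of_nonneg_left (sum_range_rpow_neg_le h0 h1 (n + 1))
          (weakLpWeight_pos n).le).trans (le_of_eq ?_)
        have hn : (0 : ℝ) < n + 1 := by positivity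
        rw [weakLpWeight, mul_left_comm, Nat.cast_succ, ← Real.rpow_add hn]
        simp

theorem eq_zero_of_marcinkiewiczGauge_eq_zero {t : ℕ → ℝ} (h0 : ∀ n, 0 < t n) {a : ℕ → ℝ}
    (ha : marcinkiewiczGauge t a = 0) : a = 0 := by
  funext k
  have h := sum_enorm_le_sum_decreasingRearrangement a {k}
  have h' : ENNReal.ofReal (t 0) * ∑ i ∈ Finset.range 1, decreasingRearrangement a i = 0 :=
    le_antisymm (ha ▸ le_iSup (fun n : ℕ => ENNReal.ofReal (t n) *
      ∑ i ∈ Finset.range (n + 1), decreasingRearrangement a i) 0) zero_le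
  rw [mul_eq_zero, or_iff_right (by simpa using h0 0)] at h'
  rw [Finset.card_singleton, h', Finset.sum_singleton] at h
  simpa using h

/-! ### The closed span of the unit vectors in weak `ℓ^p` -/

namespace WeakLp

variable {p : ℝ}

theorem hasBasis_nhds_zero (p : ℝ) : (𝓝 (0 : WeakLp p)).HasBasis (fun ε : ℝ≥0∞ => 0 < ε)
    fun ε => {x | quasiNorm x < ε} := by
  have h := (ballBasis p).toAddGroupFilterBasis.nhds_zero_hasBasis
  refine ⟨fun U => (h.mem_iff (t := U)).trans ⟨?_, ?_⟩⟩
  · rintro ⟨_, ⟨ε, hε, rfl⟩, hU⟩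
    exact ⟨ε, hε, hU⟩
  · rintro ⟨ε, hε, hU⟩
    exact ⟨_, ⟨ε, hε, rfl⟩, hU⟩

theorem mem_closure_iff_quasiNorm {S : Set (WeakLp p)} {x : WeakLp p} :
    x ∈ closure S ↔ ∀ ε : ℝ≥0∞, 0 < ε → ∃ y ∈ S, quasiNorm (x - y) < ε := by
  have hb : (𝓝 x).HasBasis (fun ε : ℝ≥0∞ => 0 < ε) fun ε => {y | quasiNorm (x - y) < ε} := by
    have h := (hasBasis_nhds_zero p).comap fun y => x - y
    have hx : Filter.comap (fun y => x - y) (𝓝 0) = 𝓝 x := by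
      have := (Homeomorph.subLeft x).isInducing.nhds_eq_comap x
      simpa using this.symm
    rwa [hx] at h
  exact mem_closure_iff_nhds_basis hb

/-- The sequence underlying an element of the closed span of the unit vectors. -/
def spanToSeq (p : ℝ) : unitVectorSpan p →ₗ[ℝ] ℕ → ℝ := (toSeq p).comp (unitVectorSpan p).subtype

theorem marcinkiewiczGauge_toSeq_le (hp : 1 < p) (x : WeakLp p) :
    marcinkiewiczGauge (weakLpWeight p) (toSeq p x) ≤
      ENNReal.ofReal (1 - 1 / p)⁻¹ * quasiNorm x :=
  marcinkiewiczGauge_le_weakLpGauge hp _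

theorem continuous_blockEval_spanToSeq (hp : 1 < p) (x : unitVectorSpan p) :
    Continuous (blockEval (weakLpWeight p) (spanToSeq p x)) := by
  refine continuous_blockEval_of_approx weakLpWeight_pos (antitone_weakLpWeight hp)
    (tendsto_weakLpWeight hp) fun ε hε => ?_
  have h1 : 1 / p < 1 := (div_lt_one (by linarith)).mpr hp
  have hK : ENNReal.ofReal (1 - 1 / p)⁻¹ ≠ 0 := by
    simpa using h1
  obtain ⟨y, hy, hxy⟩ := mem_closure_iff_quasiNorm.mp x.2 (ε / ENNReal.ofReal (1 - 1 / p)⁻¹)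
    (ENNReal.div_pos hε.ne' ENNReal.ofReal_ne_top)
  refine ⟨toSeq p y, ?_, ?_⟩
  · have := Submodule.mem_map_of_mem (f := toSeq p) hy
    rw [Submodule.map_span, ← Set.range_comp] at this
    exact this
  · refine (marcinkiewiczGauge_toSeq_le hp ((x : WeakLp p) - y)).trans_lt ?_
    rw [mul_comm]
    exact (ENNReal.lt_div_iff_mul_lt (Or.inl hK) (Or.inl ENNReal.ofReal_ne_top)).mp hxy

/-- The embedding of the closed span of the unit vectors into `C(ω ^ ω)`. -/
def spanMap (hp : 1 < p) : unitVectorSpan p →ₗ[ℝ] COrdinal (Ordinal.omega0 ^ Ordinal.omega0) :=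
  blockMap (weakLpWeight p) (spanToSeq p) (continuous_blockEval_spanToSeq hp)

theorem spanMap_apply (hp : 1 < p) (x : unitVectorSpan p) (b) :
    spanMap hp x b = blockEval (weakLpWeight p) (toSeq p x) b := rfl

theorem enorm_spanMap_le (hp : 1 < p) (x : unitVectorSpan p) :
    ‖spanMap hp x‖ₑ ≤ ENNReal.ofReal (1 - 1 / p)⁻¹ * quasiNorm (x : WeakLp p) :=
  (enorm_blockMap_le _ weakLpWeight_pos x).trans (marcinkiewiczGauge_toSeq_le hp x)

theorem weakLpGauge_le_of_forall_eq (a : ℕ → ℝ)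
    (f : COrdinal (Ordinal.omega0 ^ Ordinal.omega0))
    (hf : ∀ b, f b = blockEval (weakLpWeight p) a b) : weakLpGauge p a ≤ 2 * ‖f‖ₑ :=
  (weakLpGauge_le_marcinkiewiczGauge p a).trans
    (marcinkiewiczGauge_le_of_forall_eq weakLpWeight_pos a f hf)

theorem quasiNorm_le_spanMap (hp : 1 < p) (x : unitVectorSpan p) :
    quasiNorm (x : WeakLp p) ≤ 2 * ‖spanMap hp x‖ₑ :=
  weakLpGauge_le_of_forall_eq _ _ (spanMap_apply hp x)

theorem hasBasis_nhds_zero_unitVectorSpan (p : ℝ) :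
    (𝓝 (0 : unitVectorSpan p)).HasBasis (fun ε : ℝ≥0∞ => 0 < ε)
      fun ε => {x | quasiNorm (x : WeakLp p) < ε} := by
  rw [nhds_subtype_eq_comap]
  exact (hasBasis_nhds_zero p).comap _

theorem continuous_spanMap (hp : 1 < p) : Continuous (spanMap hp) := by
  refine continuous_of_continuousAt_zero (spanMap hp) ?_
  rw [ContinuousAt, map_zero, tendsto_iff_enorm_sub_tendsto_zero]
  simp only [sub_zero]
  have hq : Filter.Tendsto (fun x : unitVectorSpan p => quasiNorm (x : WeakLp p)) (𝓝 0) (𝓝 0) := by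
    rw [ENNReal.tendsto_nhds_zero]
    intro ε hε
    filter_upwards [(hasBasis_nhds_zero_unitVectorSpan p).mem_of_mem hε] with x hx
    exact le_of_lt hx
  have := ENNReal.Tendsto.const_mul (a := ENNReal.ofReal (1 - 1 / p)⁻¹) hq
    (Or.inr ENNReal.ofReal_ne_top)
  rw [mul_zero] at this
  exact tendsto_of_tendsto_of_tendsto_of_le_of_le tendsto_const_nhds this
    (fun _ => zero_le) (enorm_spanMap_le hp)

theorem injective_spanMap (hp : 1 < p) : Function.Injective (spanMap hp) := by
  rw [← LinearMap.ker_eq_bot, LinearMap.ker_eq_bot']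
  intro x hx
  have h0 : marcinkiewiczGauge (weakLpWeight p) (toSeq p x) ≤ 2 * ‖spanMap hp x‖ₑ :=
    marcinkiewiczGauge_le_of_forall_eq weakLpWeight_pos _ _ (spanMap_apply hp x)
  rw [hx, ← ofReal_norm, norm_zero, ENNReal.ofReal_zero, mul_zero, nonpos_iff_eq_zero] at h0
  exact Subtype.ext (Subtype.ext (eq_zero_of_marcinkiewiczGauge_eq_zero weakLpWeight_pos h0))

/-- This replaces a completeness argument for the quasi-norm: a limit `f` of the range comes from
some sequence `a`, the lower estimate puts `a` in weak `ℓ^p`, and the same estimate for differences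
puts it in the closed span. -/
theorem isClosed_range_spanMap (hp : 1 < p) :
    IsClosed (LinearMap.range (spanMap hp) :
      Set (COrdinal (Ordinal.omega0 ^ Ordinal.omega0))) := by
  refine isClosed_of_closure_subset fun f hf => ?_
  obtain ⟨a, ha⟩ := exists_eq_blockEval_of_mem_closure weakLpWeight_pos
    (by rintro _ ⟨x, rfl⟩; exact ⟨toSeq p x, spanMap_apply hp x⟩) hf
  let y : WeakLp p := ⟨a, (weakLpGauge_le_of_forall_eq a f ha).trans_lt
    (ENNReal.mul_lt_top ENNReal.ofNat_lt_top enorm_lt_top)⟩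
  have hymem : y ∈ unitVectorSpan p := by
    have hS : IsClosed (unitVectorSpan p : Set (WeakLp p)) :=
      Submodule.isClosed_topologicalClosure _
    rw [← SetLike.mem_coe, ← hS.closure_eq]
    refine mem_closure_iff_quasiNorm.mpr fun ε hε => ?_
    -- Halving `ε` compensates the factor `2` of the lower estimate.
    obtain ⟨_, ⟨x, rfl⟩, hx⟩ := EMetric.mem_closure_iff.mp hf (ε / 2) (ENNReal.half_pos hε.ne')
    refine ⟨x, x.2, ?_⟩
    refine (weakLpGauge_le_of_forall_eq (a - toSeq p x) (f - spanMap hp x) fun b => ?_).trans_lt ?_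
    · have : blockEval (weakLpWeight p) (a - toSeq p x) b = _ :=
        congrFun (map_sub (blockEvalₗ (weakLpWeight p)) a (toSeq p x)) b
      rw [this, ContinuousMap.sub_apply, ha]
      rfl
    · rw [edist_eq_enorm_sub, ENNReal.lt_div_iff_mul_lt (by simp) (by simp)] at hx
      rwa [mul_comm]
  exact ⟨⟨y, hymem⟩, ContinuousMap.ext fun b => (ha b).symm⟩

theorem embedsInto_unitVectorSpan (hp : 1 < p) :
    EmbedsInto (unitVectorSpan p) (COrdinal (Ordinal.omega0 ^ Ordinal.omega0)) := by
  set Φ := LinearEquiv.ofInjective (spanMap hp) (injective_spanMap hp)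
  refine ⟨LinearMap.range (spanMap hp), isClosed_range_spanMap hp, ⟨{ Φ with
    continuous_toFun := (continuous_spanMap hp).subtype_mk _
    continuous_invFun := ?_ }⟩⟩
  refine continuous_of_continuousAt_zero Φ.symm ?_
  rw [ContinuousAt, map_zero, (hasBasis_nhds_zero_unitVectorSpan p).tendsto_right_iff]
  intro ε hε
  have hnorm : Filter.Tendsto (fun f : LinearMap.range (spanMap hp) => 2 * ‖f‖ₑ) (𝓝 0) (𝓝 0) := by
    have := ENNReal.Tendsto.const_mul (a := 2)
      ((continuous_enorm (E := LinearMap.range (spanMap hp))).tendsto 0)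
      (Or.inr ENNReal.ofNat_ne_top)
    rwa [← ofReal_norm, norm_zero, ENNReal.ofReal_zero, mul_zero] at this
  filter_upwards [hnorm.eventually (gt_mem_nhds hε)] with f hf
  refine (quasiNorm_le_spanMap hp _).trans_lt ?_
  have : spanMap hp (Φ.symm f) = f := congrArg Subtype.val (Φ.apply_symm_apply f)
  rw [this]
  exact hf

end WeakLp

end

theorem mainTheorem6 :
    (∀ (E : Type*) [NormedAddCommGroup E] [NormedSpace ℝ E] [CompleteSpace E]
      (t : ℕ → ℝ) (e : SchauderBasis ℝ E), IsMarcinkiewiczSpace t e →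
        EmbedsInto E (COrdinal (Ordinal.omega0 ^ Ordinal.omega0))) ∧
    (∀ p : ℝ, 1 < p →
      EmbedsInto (WeakLp.unitVectorSpan p) (COrdinal (Ordinal.omega0 ^ Ordinal.omega0))) := by
  exact ⟨fun E _ _ _ t e h => h.embedsInto, fun p hp => WeakLp.embedsInto_unitVectorSpan hp⟩
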